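/- A set-algebra on a set $J$ is a family $\mathcal B$ of subsets of $J$ that contains $\emptyset$ and is closed under complements and finite unions. A setfunction on $(J,\mathcal B)$ is a map $\varphi:\mathcal B\to\mathbb R$ with $\varphi(\emptyset)=0$. It is increasing if $\varphi(X)\le\varphi(Y)$ whenever $X\subseteq Y$ in $\mathcal B$, and submodular if $\varphi(X)+\varphi(Y)\ge\varphi(X\cap Y)+\varphi(X\cup Y)$ for all $X,Y\in\mathcal B$. For $k\ge 1$ let $$Q_k(\varphi)=\{\varphi\circ F^{-1}\;:\;F:J\to[k],\ F^{-1}(A)\in\mathcal B\text{ for all }A\subseteq[k]\}\subseteq\mathbb R^{2^{[k]}},$$ and let $d^{\mathrm{Haus}}_k$ be the Hausdorff distance between subsets of the $2^k$-dimensional Euclidean space $\mathbb R^{2^{[k]}}$. A sequence $(\varphi_n)$ of setfunctions, each on its own set-algebra $(J_n,\mathcal B_n)$, is quotient-convergent if for every $k\ge1$ the sequence $(Q_k(\varphi_n))_n$ is Cauchy in $d^{\mathrm{Haus}}_k$; it quotient-converges to $\varphi$, written $\varphi_n\rightarrowtail\varphi$, if $d^{\mathrm{Haus}}_k(Q_k(\varphi_n),Q_k(\varphi))\to0$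 for every $k\ge1$. The quotient pseudometric is $$d(\varphi,\psi)=\sum_{k=1}^\infty 2^{-k}\,d^{\mathrm{Haus}}_k\bigl(Q_k(\varphi),Q_k(\psi)\bigr).$$ Theorem. Let $(\varphi_n)$ be a quotient-convergent sequence of increasing submodular setfunctions on arbitrary set-algebras. Then there is an increasing submodular setfunction $\varphi$ on the Borel sets of the Cantor set such that $\varphi_n\rightarrowtail\varphi$; moreover $d(\varphi_n,\varphi)\to0$. Consequently, the space of all increasing submodular setfunctions on set-algebras, endowed with the quotient pseudometric $d$, is complete. -/

import Mathlib

open Set Filter Topology Metric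
open scoped ENNReal MeasureTheory

universe u v w

/-- A setfunction on a set-algebra `𝓑` of subsets of `J` (a Boolean subalgebra of the power set
of `J`): a real function on the members of `𝓑` that vanishes on the empty set. -/
structure SetFunction {J : Type u} (𝓑 : BooleanSubalgebra (Set J)) where
  toFun : 𝓑 → ℝ
  map_empty : toFun ⊥ = 0

namespace SetFunction

variable {J : Type u} {𝓑 : BooleanSubalgebra (Set J)}
  {J' : Type v} {𝓑' : BooleanSubalgebra (Set J')}

/-- `X ⊆ Y` implies `φ X ≤ φ Y`. -/
def Increasing (φ : SetFunction 𝓑) : Prop :=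
  ∀ X Y : 𝓑, (X : Set J) ⊆ (Y : Set J) → φ.toFun X ≤ φ.toFun Y

/-- `φ (X ∩ Y) + φ (X ∪ Y) ≤ φ X + φ Y`; the lattice operations of `𝓑` are `∩` and `∪`. -/
def Submodular (φ : SetFunction 𝓑) : Prop :=
  ∀ X Y : 𝓑, φ.toFun (X ⊓ Y) + φ.toFun (X ⊔ Y) ≤ φ.toFun X + φ.toFun Y

/-- The `k`-quotient set: all setfunctions `A ↦ φ (F ⁻¹ A)` on the subsets of a `k`-element set,
where `F : J → [k]` is measurable; a subset of the `2 ^ k`-dimensional Euclidean space. -/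
def quotientSet (φ : SetFunction 𝓑) (k : ℕ) : Set (EuclideanSpace ℝ (Set (Fin k))) :=
  {v | ∃ (F : J → Fin k) (hF : ∀ A : Set (Fin k), F ⁻¹' A ∈ 𝓑),
    ∀ A : Set (Fin k), v A = φ.toFun ⟨F ⁻¹' A, hF A⟩}

/-- For every `k ≥ 1` the quotient sets `Q_k (φ n)` form a Cauchy sequence in the Hausdorff
distance. -/
def QuotientConvergent {J : ℕ → Type u} {𝓑 : ∀ n, BooleanSubalgebra (Set (J n))}
    (φ : ∀ n, SetFunction (𝓑 n)) : Prop :=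
  ∀ k : ℕ, 1 ≤ k → ∀ ε : ℝ≥0∞, 0 < ε → ∃ N : ℕ, ∀ m, N ≤ m → ∀ n, N ≤ n →
    hausdorffEDist ((φ m).quotientSet k) ((φ n).quotientSet k) < ε

/-- For every `k ≥ 1` the quotient sets `Q_k (φ n)` converge to `Q_k ψ` in the Hausdorff
distance. -/
def QuotientConvergesTo {J : ℕ → Type u} {𝓑 : ∀ n, BooleanSubalgebra (Set (J n))}
    (φ : ∀ n, SetFunction (𝓑 n)) (ψ : SetFunction 𝓑') : Prop :=
  ∀ k : ℕ, 1 ≤ k →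
    Tendsto (fun n => hausdorffEDist ((φ n).quotientSet k) (ψ.quotientSet k)) atTop (𝓝 0)

/-- The quotient distance `∑_{k ≥ 1} 2 ^ (-k) d_H (Q_k φ, Q_k ψ)`, as an extended real. -/
noncomputable def quotientEDist (φ : SetFunction 𝓑) (ψ : SetFunction 𝓑') : ℝ≥0∞ :=
  ∑' k : ℕ, (2⁻¹ : ℝ≥0∞) ^ (k + 1) *
    hausdorffEDist (φ.quotientSet (k + 1)) (ψ.quotientSet (k + 1))

theorem quotientEDist_triangle {J'' : Type w} {𝓑'' : BooleanSubalgebra (Set J'')}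
    (φ : SetFunction 𝓑) (ψ : SetFunction 𝓑') (χ : SetFunction 𝓑'') :
    φ.quotientEDist χ ≤ φ.quotientEDist ψ + ψ.quotientEDist χ := by
  unfold quotientEDist
  rw [← ENNReal.tsum_add]
  refine ENNReal.tsum_le_tsum fun k => ?_
  rw [← mul_add]
  gcongr
  exact hausdorffEDist_triangle

theorem quotientSet_nonempty (φ : SetFunction 𝓑) (k : ℕ) :
    (φ.quotientSet (k + 1)).Nonempty := by
  classical
  have h : ∀ A : Set (Fin (k + 1)), (fun _ : J => (0 : Fin (k + 1))) ⁻¹' A ∈ 𝓑 := by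
    intro A
    by_cases hA : (0 : Fin (k + 1)) ∈ A
    · rw [Set.preimage_const_of_mem hA]; exact 𝓑.top_mem
    · rw [Set.preimage_const_of_notMem hA]; exact 𝓑.bot_mem
  exact ⟨WithLp.toLp 2 fun A => φ.toFun ⟨_, h A⟩, _, h, fun _ => rfl⟩

theorem edist_le_of_mem_quotientSet {φ : SetFunction 𝓑} {ψ : SetFunction 𝓑'}
    (hφ : φ.Increasing) (hψ : ψ.Increasing) {k : ℕ} {x y : EuclideanSpace ℝ (Set (Fin k))}
    (hx : x ∈ φ.quotientSet k) (hy : y ∈ ψ.quotientSet k) :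
    edist x y ≤ ENNReal.ofReal (√2 ^ k * (φ.toFun ⊤ + ψ.toFun ⊤)) := by
  obtain ⟨F, hF, hx⟩ := hx
  obtain ⟨G, hG, hy⟩ := hy
  have h1 : ∀ X : 𝓑, 0 ≤ φ.toFun X ∧ φ.toFun X ≤ φ.toFun ⊤ := fun X =>
    ⟨φ.map_empty ▸ hφ ⊥ X (Set.empty_subset _), hφ X ⊤ (Set.subset_univ _)⟩
  have h2 : ∀ X : 𝓑', 0 ≤ ψ.toFun X ∧ ψ.toFun X ≤ ψ.toFun ⊤ := fun X =>
    ⟨ψ.map_empty ▸ hψ ⊥ X (Set.empty_subset _), hψ X ⊤ (Set.subset_univ _)⟩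
  have hM : 0 ≤ φ.toFun ⊤ + ψ.toFun ⊤ := add_nonneg (h1 _).1 (h2 _).1
  rw [edist_dist]
  apply ENNReal.ofReal_le_ofReal
  rw [EuclideanSpace.dist_eq]
  apply Real.sqrt_le_iff.2
  refine ⟨by positivity, ?_⟩
  calc ∑ A, dist (x A) (y A) ^ 2
      ≤ ∑ _A : Set (Fin k), (φ.toFun ⊤ + ψ.toFun ⊤) ^ 2 := by
        refine Finset.sum_le_sum fun A _ => ?_
        gcongr
        rw [hx A, hy A, Real.dist_eq, abs_le]
        have a := h1 ⟨F ⁻¹' A, hF A⟩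
        have b := h2 ⟨G ⁻¹' A, hG A⟩
        have c := h1 ⊤
        have d := h2 ⊤
        constructor <;> linarith
    _ = (√2 ^ k * (φ.toFun ⊤ + ψ.toFun ⊤)) ^ 2 := by
        rw [Finset.sum_const, Finset.card_univ, Fintype.card_set, Fintype.card_fin, mul_pow,
          ← pow_mul, mul_comm k 2, pow_mul, Real.sq_sqrt (by norm_num), nsmul_eq_mul]
        push_cast
        ring

/-- The quotient distance of increasing setfunctions is finite. -/
theorem quotientEDist_ne_top {φ : SetFunction 𝓑} {ψ : SetFunction 𝓑'}
    (hφ : φ.Increasing) (hψ : ψ.Increasing) : φ.quotientEDist ψ ≠ ⊤ := by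
  have hM : 0 ≤ φ.toFun ⊤ + ψ.toFun ⊤ := by
    have a := hφ ⊥ ⊤ (Set.empty_subset _)
    have b := hψ ⊥ ⊤ (Set.empty_subset _)
    rw [φ.map_empty] at a
    rw [ψ.map_empty] at b
    exact add_nonneg a b
  have hs : √2 / 2 < 1 := by
    have : √2 < 2 := by
      rw [Real.sqrt_lt' (by norm_num)]; norm_num
    linarith
  have hsum : Summable fun k : ℕ => (√2 / 2) ^ (k + 1) * (φ.toFun ⊤ + ψ.toFun ⊤) :=
    ((summable_nat_add_iff 1).2 (summable_geometric_of_lt_one (by positivity) hs)).mul_right _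
  refine ne_top_of_le_ne_top hsum.tsum_ofReal_ne_top (ENNReal.tsum_le_tsum fun k => ?_)
  have h2 : (2⁻¹ : ℝ≥0∞) ^ (k + 1) = ENNReal.ofReal ((2⁻¹ : ℝ) ^ (k + 1)) := by
    rw [ENNReal.ofReal_pow (by norm_num), ENNReal.ofReal_inv_of_pos (by norm_num)]
    simp
  have h3 : hausdorffEDist (φ.quotientSet (k + 1)) (ψ.quotientSet (k + 1)) ≤
      ENNReal.ofReal (√2 ^ (k + 1) * (φ.toFun ⊤ + ψ.toFun ⊤)) := by
    obtain ⟨x₀, hx₀⟩ := φ.quotientSet_nonempty k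
    obtain ⟨y₀, hy₀⟩ := ψ.quotientSet_nonempty k
    refine hausdorffEDist_le_of_mem_edist
      (fun x hx => ⟨y₀, hy₀, edist_le_of_mem_quotientSet hφ hψ hx hy₀⟩)
      (fun y hy => ⟨x₀, hx₀, ?_⟩)
    rw [edist_comm]
    exact edist_le_of_mem_quotientSet hφ hψ hx₀ hy
  calc (2⁻¹ : ℝ≥0∞) ^ (k + 1) *
        hausdorffEDist (φ.quotientSet (k + 1)) (ψ.quotientSet (k + 1))
      ≤ ENNReal.ofReal ((2⁻¹ : ℝ) ^ (k + 1)) *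
        ENNReal.ofReal (√2 ^ (k + 1) * (φ.toFun ⊤ + ψ.toFun ⊤)) := by
        rw [h2]; gcongr
    _ = ENNReal.ofReal ((√2 / 2) ^ (k + 1) * (φ.toFun ⊤ + ψ.toFun ⊤)) := by
        rw [← ENNReal.ofReal_mul (by positivity), ← mul_assoc, ← mul_pow]
        congr 3
        ring

end SetFunction

/-- The algebra of Borel subsets of a topological space. -/
def borelAlgebra (X : Type u) [TopologicalSpace X] : BooleanSubalgebra (Set X) where
  carrier := {s | MeasurableSet[borel X] s}
  supClosed' := fun _ hs _ ht => @MeasurableSet.union X (borel X) _ _ hs ht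
  infClosed' := fun _ hs _ ht => @MeasurableSet.inter X (borel X) _ _ hs ht
  compl_mem' := fun hs => @MeasurableSet.compl X _ (borel X) hs
  bot_mem' := @MeasurableSet.empty X (borel X)

/-- The space of all increasing submodular setfunctions on arbitrary set-algebras. -/
structure IncreasingSubmodularSpace : Type (u + 1) where
  ground : Type u
  algebra : BooleanSubalgebra (Set ground)
  setFunction : SetFunction algebra
  increasing : setFunction.Increasing
  submodular : setFunction.Submodular

/-- The quotient pseudometric `d (φ, ψ) = ∑_{k ≥ 1} 2 ^ (-k) d_H (Q_k φ, Q_k ψ)`. -/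
noncomputable instance : PseudoMetricSpace IncreasingSubmodularSpace.{u} :=
  @PseudoEMetricSpace.toPseudoMetricSpace IncreasingSubmodularSpace.{u}
    { edist := fun φ ψ => φ.setFunction.quotientEDist ψ.setFunction
      edist_self := fun φ => by
        simp [SetFunction.quotientEDist]
      edist_comm := fun φ ψ => by
        simp only [SetFunction.quotientEDist, hausdorffEDist_comm]
      edist_triangle := fun φ ψ χ => SetFunction.quotientEDist_triangle _ _ _ }
    fun φ ψ => SetFunction.quotientEDist_ne_top φ.increasing ψ.increasing

/-! The limit is built on the clopen sets of the Cantor set and then extended to the Borel sets as a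
capacity.

By completeness, `Q_k (φ n)` converges to a closed set `L_k`. Take a dense sequence in each `L_k`,
approximate each of its points by quotients of `φ n`, and combine the countably many quotient maps
on `J n` into one map `H n` to the Cantor set, from which fixed continuous maps `p` recover them
(`exists_cantorSet_factorization`). The ultralimit of the setfunctions pushed forward along `H n` is
an increasing submodular function `f` on clopen sets (`exists_clopen_ultralimit`). Its quotients
along continuous maps lie in `L_k`, and those along `p` give the dense points.

It remains to extend `f` to Borel sets without leaving `L_k`. The extension need not be countably
additive, so measure theory is replaced by Choquet's capacitability theorem: the outer capacity of
`f` is submodular and continuous along increasing sequences, hence Borel sets are approximated from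
inside by compact sets as well as from outside by open ones (`exists_compact_lt_outer`). A Borel
partition squeezed in this way is close in capacity to a clopen partition
(`exists_continuous_approx`), so every Borel quotient is a limit of continuous ones. -/

/-- A real function on sets that, restricted to the clopen sets, is an increasing submodular
setfunction. -/
structure IsClopenSubmodular {X : Type u} [TopologicalSpace X] (f : Set X → ℝ) : Prop where
  empty : f ∅ = 0
  mono : ∀ {C D : Set X}, IsClopen C → IsClopen D → C ⊆ D → f C ≤ f D
  submod : ∀ {C D : Set X}, IsClopen C → IsClopen D → f (C ∩ D) + f (C ∪ D) ≤ f C + f D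

/-- The supremum of a setfunction over the clopen subsets of a set. -/
noncomputable def clopenInner {X : Type u} [TopologicalSpace X] (f : Set X → ℝ) (U : Set X) : ℝ :=
  sSup (f '' {C | IsClopen C ∧ C ⊆ U})

/-- The outer capacity generated by the values of a setfunction on the clopen sets. -/
noncomputable def clopenOuter {X : Type u} [TopologicalSpace X] (f : Set X → ℝ) (S : Set X) : ℝ :=
  sInf (clopenInner f '' {U | IsOpen U ∧ S ⊆ U})

/-- An open cover of a profinite space is refined by the fibres of a continuous function to its
index set. -/
theorem exists_continuous_subordinate {X : Type u} [TopologicalSpace X] [CompactSpace X] [T2Space X]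
    [TotallyDisconnectedSpace X] {ι : Type v} [TopologicalSpace ι] [DiscreteTopology ι]
    {V : ι → Set X} (hV : ∀ i, IsOpen (V i)) (hc : ∀ x, ∃ i, x ∈ V i) :
    ∃ F : X → ι, Continuous F ∧ ∀ x, x ∈ V (F x) := by
  have hU : TopologicalSpace.IsOpenCover fun i => (⟨V i, hV i⟩ : TopologicalSpace.Opens X) :=
    .of_sets hV (iUnion_eq_univ_iff.2 hc)
  obtain ⟨n, W, h1, h2, h3⟩ := hU.exists_finite_nonempty_disjoint_clopen_cover
  have hx : ∀ x, ∃ j, x ∈ W j := fun x => by simpa using h2 (mem_univ x)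
  choose j hj using hx
  choose r hr using fun j => (h1 j).2
  refine ⟨fun x => r (j x), ?_, fun x => hr _ (hj x)⟩
  apply continuous_of_discreteTopology.comp
  rw [continuous_discrete_rng]
  intro i
  convert (W i).isClopen.isOpen
  ext x
  refine ⟨fun h => ?_, fun h => ?_⟩
  · rw [← (h : j x = i)]; exact hj x
  · by_contra hne
    have := h3 hne
    exact Set.disjoint_left.1 (TopologicalSpace.Clopens.coe_disjoint.2 this) (hj x) h

/-- Boxes in the Baire space are compact. -/
theorem isCompact_setOf_forall_le (n : ℕ → ℕ) : IsCompact {σ : ℕ → ℕ | ∀ i, σ i ≤ n i} := by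
  have : {σ : ℕ → ℕ | ∀ i, σ i ≤ n i} = Set.pi univ fun i => Iic (n i) := by
    ext
    simp only [mem_ofPred_eq, mem_univ_pi, mem_Iic]
  rw [this]
  exact isCompact_univ_pi fun i => (finite_Iic _).isCompact

/-! ### Submodularity of the outer capacity. -/

namespace IsClopenSubmodular

variable {X : Type u} [TopologicalSpace X] {f : Set X → ℝ} (hf : IsClopenSubmodular f)
include hf

theorem bddAbove (U : Set X) : BddAbove (f '' {C | IsClopen C ∧ C ⊆ U}) :=
  ⟨f univ, by rintro _ ⟨C, hC, rfl⟩; exact hf.mono hC.1 isClopen_univ (subset_univ _)⟩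

theorem le_inner {C U : Set X} (hC : IsClopen C) (h : C ⊆ U) : f C ≤ clopenInner f U :=
  le_csSup (hf.bddAbove U) ⟨C, ⟨hC, h⟩, rfl⟩

omit hf in
theorem inner_le {U : Set X} {b : ℝ} (h : ∀ C, IsClopen C → C ⊆ U → f C ≤ b) :
    clopenInner f U ≤ b :=
  csSup_le ⟨_, ∅, ⟨isClopen_empty, empty_subset _⟩, rfl⟩
    (by rintro _ ⟨C, hC, rfl⟩; exact h C hC.1 hC.2)

theorem inner_nonneg (U : Set X) : 0 ≤ clopenInner f U :=
  hf.empty ▸ hf.le_inner isClopen_empty (empty_subset U)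

theorem inner_mono {U V : Set X} (h : U ⊆ V) : clopenInner f U ≤ clopenInner f V :=
  inner_le fun _ hC hCU => hf.le_inner hC (hCU.trans h)

theorem inner_clopen {C : Set X} (hC : IsClopen C) : clopenInner f C = f C :=
  le_antisymm (inner_le fun _ hD hDC => hf.mono hD hC hDC) (hf.le_inner hC subset_rfl)

theorem outer_le {S U : Set X} (hU : IsOpen U) (h : S ⊆ U) : clopenOuter f S ≤ clopenInner f U :=
  csInf_le ⟨0, by rintro _ ⟨V, -, rfl⟩; exact hf.inner_nonneg V⟩ ⟨U, ⟨hU, h⟩, rfl⟩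

omit hf in
theorem le_outer {S : Set X} {b : ℝ} (h : ∀ U, IsOpen U → S ⊆ U → b ≤ clopenInner f U) :
    b ≤ clopenOuter f S :=
  le_csInf ⟨_, univ, ⟨isOpen_univ, subset_univ _⟩, rfl⟩
    (by rintro _ ⟨U, hU, rfl⟩; exact h U hU.1 hU.2)

omit hf in
theorem exists_inner_lt (S : Set X) {ε : ℝ} (hε : 0 < ε) :
    ∃ U, IsOpen U ∧ S ⊆ U ∧ clopenInner f U < clopenOuter f S + ε := by
  by_contra! h
  linarith [le_outer h]

theorem outer_mono {S T : Set X} (h : S ⊆ T) : clopenOuter f S ≤ clopenOuter f T :=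
  le_outer fun _ hU hTU => hf.outer_le hU (h.trans hTU)

theorem outer_open {U : Set X} (hU : IsOpen U) : clopenOuter f U = clopenInner f U :=
  le_antisymm (hf.outer_le hU subset_rfl) (le_outer fun _ _ h => hf.inner_mono h)

theorem outer_clopen {C : Set X} (hC : IsClopen C) : clopenOuter f C = f C := by
  rw [hf.outer_open hC.isOpen, hf.inner_clopen hC]

theorem outer_empty : clopenOuter f ∅ = 0 := by
  rw [hf.outer_clopen isClopen_empty, hf.empty]

variable [CompactSpace X]

/-- By compactness, a clopen subset of an increasing union of open sets lies in one of them. -/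
theorem inner_iUnion_le {V : ℕ → Set X} (hV : ∀ n, IsOpen (V n)) (hm : Monotone V) {b : ℝ}
    (hb : ∀ n, clopenInner f (V n) ≤ b) : clopenInner f (⋃ n, V n) ≤ b := by
  refine inner_le fun C hC hCV => ?_
  obtain ⟨n, hn⟩ := hC.isClosed.isCompact.elim_directed_cover V hV hCV hm.directed_le
  exact (hf.le_inner hC hn).trans (hb n)

variable [T2Space X] [TotallyDisconnectedSpace X]

omit hf in
-- Intersect `D` with the two fibres of a continuous map subordinate to the cover `U`, `V ∪ Dᶜ`.
theorem exists_clopen_union {D U V : Set X} (hD : IsClopen D) (hU : IsOpen U) (hV : IsOpen V)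
    (h : D ⊆ U ∪ V) :
    ∃ A B, IsClopen A ∧ IsClopen B ∧ A ⊆ U ∧ B ⊆ V ∧ D = A ∪ B := by
  obtain ⟨F, hF, hFV⟩ := exists_continuous_subordinate
    (V := fun b : Bool => cond b U (V ∪ Dᶜ))
    (by rintro (_ | _); exacts [hV.union hD.compl.isOpen, hU])
    (fun x => by
      by_cases hx : x ∈ D
      · rcases h hx with h | h
        exacts [⟨true, h⟩, ⟨false, Or.inl h⟩]
      · exact ⟨false, Or.inr hx⟩)
  refine ⟨D ∩ F ⁻¹' {true}, D ∩ F ⁻¹' {false}, hD.inter ((isClopen_discrete _).preimage hF),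
    hD.inter ((isClopen_discrete _).preimage hF), fun x hx => ?_, fun x hx => ?_, ?_⟩
  · have := hFV x
    rw [show F x = true from hx.2] at this
    exact this
  · have := hFV x
    rw [show F x = false from hx.2] at this
    exact this.resolve_right fun h => h hx.1
  · rw [← inter_union_distrib_left, ← preimage_union]
    ext x
    cases h : F x <;> simp [h]

/-- For clopen `C ⊆ U ∩ V` and `D = A ∪ B ⊆ U ∪ V` with `A ⊆ U`, `B ⊆ V`, submodularity is applied
to `C ∪ A ⊆ U` and `C ∪ B ⊆ V`, whose intersection contains `C` and whose union contains `D`. -/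
theorem inner_submod {U V : Set X} (hU : IsOpen U) (hV : IsOpen V) :
    clopenInner f (U ∩ V) + clopenInner f (U ∪ V) ≤ clopenInner f U + clopenInner f V := by
  rw [← le_sub_iff_add_le]
  refine inner_le fun C hC hCU => ?_
  rw [le_sub_comm]
  refine inner_le fun D hD hDU => ?_
  obtain ⟨A, B, hA, hB, hAU, hBV, rfl⟩ := exists_clopen_union hD hU hV hDU
  have h1 := hf.submod (hC.union hA) (hC.union hB)
  have h2 := hf.mono hC ((hC.union hA).inter (hC.union hB))
    (subset_inter subset_union_left subset_union_left)
  have h3 := hf.mono hD ((hC.union hA).union (hC.union hB))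
    (union_subset_union subset_union_right subset_union_right)
  have h4 := hf.le_inner (hC.union hA) (union_subset (hCU.trans inter_subset_left) hAU)
  have h5 := hf.le_inner (hC.union hB) (union_subset (hCU.trans inter_subset_right) hBV)
  linarith

theorem outer_submod (S T : Set X) :
    clopenOuter f (S ∩ T) + clopenOuter f (S ∪ T) ≤ clopenOuter f S + clopenOuter f T := by
  refine le_of_forall_pos_le_add fun ε hε => ?_
  obtain ⟨U, hU, hSU, h1⟩ := exists_inner_lt (f := f) S (half_pos hε)
  obtain ⟨V, hV, hTV, h2⟩ := exists_inner_lt (f := f) T (half_pos hε)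
  have h3 := hf.inner_submod hU hV
  have h4 := hf.outer_le (hU.inter hV) (inter_subset_inter hSU hTV)
  have h5 := hf.outer_le (hU.union hV) (union_subset_union hSU hTV)
  linarith

/-- Enlarging finitely many sets increases the capacity of the union by at most the sum of the
increments. -/
theorem outer_biUnion_le {ι : Type v} (s : Finset ι) {S T : ι → Set X} {ε : ℝ}
    (h : ∀ i, S i ⊆ T i) (hε : ∀ i, clopenOuter f (T i) ≤ clopenOuter f (S i) + ε) :
    clopenOuter f (⋃ i ∈ s, T i) ≤ clopenOuter f (⋃ i ∈ s, S i) + s.card * ε := by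
  classical
  induction s using Finset.induction_on with
  | empty => simp
  | insert a s ha ih =>
    rw [Finset.set_biUnion_insert, Finset.set_biUnion_insert, Finset.card_insert_of_notMem ha]
    set A := ⋃ i ∈ s, S i
    set B := ⋃ i ∈ s, T i
    have hAB : A ⊆ B := iUnion₂_mono fun i _ => h i
    -- Diminishing returns, twice: replacing `S a` by `T a` costs at most `ε` in the presence of
    -- `A`, and replacing `A` by `B` costs no more in the presence of `T a` than alone.
    have h1 := hf.outer_submod (T a) (S a ∪ A)
    have h2 := hf.outer_submod (T a ∪ A) B
    have h3 := hf.outer_mono (show S a ⊆ T a ∩ (S a ∪ A) from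
      subset_inter (h a) subset_union_left)
    have h4 := hf.outer_mono (show A ⊆ (T a ∪ A) ∩ B from subset_inter subset_union_right hAB)
    have h5 := hf.outer_mono (show T a ∪ A ⊆ T a ∪ (S a ∪ A) from
      union_subset_union_right _ subset_union_right)
    have h6 := hf.outer_mono (show T a ∪ B ⊆ T a ∪ A ∪ B from
      union_subset_union_left _ subset_union_left)
    have h7 := hε a
    push_cast
    linarith

/-! ### Choquet capacitability and clopen approximation. -/

/-- The outer capacity is continuous along increasing sequences of sets. -/
theorem exists_lt_outer_of_iUnion {S : ℕ → Set X} (hm : Monotone S) {c : ℝ}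
    (hc : c < clopenOuter f (⋃ n, S n)) : ∃ n, c < clopenOuter f (S n) := by
  by_contra! hle
  obtain ⟨ε, hε, hcε⟩ : ∃ ε > 0, c + ε < clopenOuter f (⋃ n, S n) :=
    ⟨(clopenOuter f (⋃ n, S n) - c) / 2, by linarith, by linarith⟩
  choose U hU hSU hlt using fun n : ℕ =>
    exists_inner_lt (f := f) (S n) (ε := ε / 2 ^ (n + 1)) (by positivity)
  have hV : ∀ n, IsOpen (⋃ i ≤ n, U i) := fun n => isOpen_biUnion fun i _ => hU i
  have hVm : Monotone fun n => ⋃ i ≤ n, U i := fun m n hmn =>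
    biUnion_subset_biUnion_left fun i hi => le_trans hi hmn
  -- The union up to `n` and `U (n + 1)` both contain `S n`, so by submodularity the errors `ε / 2 ^
  -- (i + 1)` merely add up, to less than `ε`.
  have key : ∀ n, clopenInner f (⋃ i ≤ n, U i) ≤
      clopenOuter f (S n) + ε * (1 - 1 / 2 ^ (n + 1)) := by
    intro n
    induction n with
    | zero =>
      have := (hlt 0).le
      simp only [nonpos_iff_eq_zero, iUnion_iUnion_eq_left]
      norm_num at this ⊢
      linarith
    | succ n ih =>
      have e : (⋃ i ≤ n + 1, U i) = (⋃ i ≤ n, U i) ∪ U (n + 1) := by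
        simp only [Set.biUnion_le_succ]
      have h1 := hf.inner_submod (hV n) (hU (n + 1))
      have h2 := hf.outer_le ((hV n).inter (hU (n + 1))) (S := S n)
        (subset_inter ((hSU n).trans (subset_biUnion_of_mem (u := U) (le_refl n)))
          ((hm n.le_succ).trans (hSU _)))
      have h3 := hlt (n + 1)
      rw [e]
      have h4 : ε * (1 - 1 / 2 ^ (n + 1 + 1)) =
          ε * (1 - 1 / 2 ^ (n + 1)) + ε / 2 ^ (n + 1 + 1) := by
        field_simp; ring
      linarith
  have h1 : clopenInner f (⋃ n, ⋃ i ≤ n, U i) ≤ c + ε := by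
    refine hf.inner_iUnion_le hV hVm fun n => (key n).trans ?_
    have : (0 : ℝ) < 1 / 2 ^ (n + 1) := by positivity
    nlinarith [hle n]
  have h2 := hf.outer_le (S := ⋃ n, S n) (isOpen_iUnion hV)
    (iUnion_mono fun n => (hSU n).trans (subset_biUnion_of_mem (u := U) (le_refl n)))
  linarith

omit hf [CompactSpace X] [T2Space X] [TotallyDisconnectedSpace X] in
/-- If an open set contains the continuous image of the box `{σ | ∀ i, σ i ≤ n i}`, then it contains
the image of a set given by finitely many of these inequalities. -/
theorem exists_image_subset_of_box {g : (ℕ → ℕ) → X} (hg : Continuous g) {n : ℕ → ℕ} {U : Set X}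
    (hU : IsOpen U) (h : g '' {σ | ∀ i, σ i ≤ n i} ⊆ U) :
    ∃ m, g '' {σ | ∀ i < m, σ i ≤ n i} ⊆ U := by
  by_contra! hm
  have hm' : ∀ m, ∃ σ : ℕ → ℕ, (∀ i < m, σ i ≤ n i) ∧ g σ ∉ U := fun m => by
    obtain ⟨_, ⟨σ, hσ, rfl⟩, h'⟩ := not_subset.1 (hm m)
    exact ⟨σ, hσ, h'⟩
  choose σ hσ hσU using hm'
  -- Truncating `σ m` at `n` puts it in the compact box and changes no coordinate below `m`, so a
  -- limit of the truncations is also a limit of the `σ m` themselves.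
  obtain ⟨τ, hτ, p, hp, hlim⟩ := (isCompact_setOf_forall_le n).tendsto_subseq
    (x := fun m i => min (σ m i) (n i)) fun m i => min_le_right _ _
  have hlim' : Tendsto (fun m => σ (p m)) atTop (𝓝 τ) := by
    rw [tendsto_pi_nhds] at hlim ⊢
    intro i
    refine (hlim i).congr' ?_
    filter_upwards [eventually_gt_atTop i] with m hmi
    exact min_eq_left (hσ _ _ (hmi.trans_le (hp.id_le m)))
  obtain ⟨m, hm⟩ := ((hg.tendsto τ).comp hlim' |>.eventually
    (hU.mem_nhds (h ⟨τ, hτ, rfl⟩))).exists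
  exact hσU _ hm

/-- Analytic sets are capacitable. -/
theorem exists_compact_lt_outer {S : Set X} (hS : MeasureTheory.AnalyticSet S) {c : ℝ}
    (hc : c < clopenOuter f S) : ∃ K ⊆ S, IsCompact K ∧ c ≤ clopenOuter f K := by
  rw [MeasureTheory.AnalyticSet] at hS
  obtain rfl | ⟨g, hg, rfl⟩ := hS
  · exact ⟨∅, subset_rfl, isCompact_empty, hc.le⟩
  -- Bound the coordinates one at a time, keeping the capacity of the image above `c`. The subtype
  -- carries this invariant through the recursion.
  have step : ∀ (m : ℕ) (T : {T : Set (ℕ → ℕ) // c < clopenOuter f (g '' T)}),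
      ∃ j, c < clopenOuter f (g '' (T.1 ∩ {σ | σ m ≤ j})) := by
    intro m T
    apply hf.exists_lt_outer_of_iUnion
    · intro i j hij
      exact image_mono (inter_subset_inter_right _ fun σ hσ => le_trans hσ hij)
    · convert T.2
      rw [← image_iUnion, ← inter_iUnion]
      congr 1
      rw [inter_eq_left]
      exact fun σ _ => mem_iUnion.2 ⟨σ m, le_refl (σ m)⟩
  choose j hj using step
  let T : ℕ → {T : Set (ℕ → ℕ) // c < clopenOuter f (g '' T)} := fun m =>
    Nat.rec ⟨univ, by rwa [image_univ]⟩ (fun m T => ⟨_, hj m T⟩) m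
  have hT : ∀ m, (T m).1 = {σ | ∀ i < m, σ i ≤ j i (T i)} := by
    intro m
    induction m with
    | zero => ext; simp [T]
    | succ m ih =>
      have : (T (m + 1)).1 = (T m).1 ∩ {σ | σ m ≤ j m (T m)} := rfl
      rw [this, ih]
      ext σ
      simp only [mem_inter_iff, mem_ofPred_eq, Nat.lt_succ_iff_lt_or_eq]
      exact ⟨fun h i hi => hi.elim (h.1 i) fun e => e ▸ h.2,
        fun h => ⟨fun i hi => h i (Or.inl hi), h m (Or.inr rfl)⟩⟩
  refine ⟨g '' {σ | ∀ i, σ i ≤ j i (T i)}, image_subset_range _ _, ?_, ?_⟩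
  · exact (isCompact_setOf_forall_le _).image hg
  -- The capacity need not be continuous along decreasing sequences of arbitrary sets; here an open
  -- set around the final image already contains the image of a finite stage.
  · refine le_outer fun U hU hKU => ?_
    obtain ⟨m, hm⟩ := exists_image_subset_of_box hg hU hKU
    rw [← hT] at hm
    exact (T m).2.le.trans (hf.outer_le hU hm)

/-- The values of the outer capacity on a finite partition into capacitable sets are approximated by
its values on a clopen partition. -/
theorem exists_continuous_approx {k : ℕ} {G : X → Fin k}
    (hG : ∀ i, MeasureTheory.AnalyticSet (G ⁻¹' {i})) {ε : ℝ} (hε : 0 < ε) :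
    ∃ F : X → Fin k, Continuous F ∧
      ∀ A : Set (Fin k), |clopenOuter f (G ⁻¹' A) - f (F ⁻¹' A)| ≤ k * ε := by
  classical
  choose K hKG hK hKε using fun i =>
    hf.exists_compact_lt_outer (hG i) (c := clopenOuter f (G ⁻¹' {i}) - ε) (by linarith)
  choose U hU hGU hUε using fun i => exists_inner_lt (f := f) (G ⁻¹' {i}) hε
  -- Removing the other compact sets from `U i` forces `K i ⊆ F ⁻¹' {i} ⊆ U i`. So `F ⁻¹' A` and `G
  -- ⁻¹' A` both lie between the same unions of `K i` and of `U i`.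
  obtain ⟨F, hF, hFV⟩ := exists_continuous_subordinate
    (V := fun i => U i \ ⋃ j ∈ {j | j ≠ i}, K j)
    (fun i => (hU i).sdiff ((toFinite _).isClosed_biUnion fun j _ => (hK j).isClosed))
    (fun x => ⟨G x, hGU _ rfl, by
      simp only [mem_iUnion, not_exists]
      exact fun j hj hx => hj (hKG j hx).symm⟩)
  refine ⟨F, hF, fun A => ?_⟩
  have hKF : ∀ i, K i ⊆ F ⁻¹' {i} := fun i x hx => by
    by_contra hne
    exact (hFV x).2 (mem_biUnion (Ne.symm hne) hx)
  have hFU : ∀ i, F ⁻¹' {i} ⊆ U i := fun i x hx => by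
    have : F x = i := hx
    exact this ▸ (hFV x).1
  have hcover : ∀ H : X → Fin k, H ⁻¹' A = ⋃ i ∈ A.toFinset, H ⁻¹' {i} := fun H => by
    ext x; simp
  have hcard : (A.toFinset.card : ℝ) * ε ≤ k * ε := by
    gcongr
    exact (Finset.card_le_univ _).trans_eq (Fintype.card_fin k)
  have h1 := hf.outer_biUnion_le A.toFinset hKG (ε := ε) fun i => by linarith [hKε i]
  have h2 := hf.outer_biUnion_le A.toFinset hGU (ε := ε) fun i => by
    rw [hf.outer_open (hU i)]; exact (hUε i).le
  have h3 := hf.outer_mono (iUnion₂_mono (κ := fun i => i ∈ A.toFinset) fun i _ => hKF i)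
  have h4 := hf.outer_mono (iUnion₂_mono (κ := fun i => i ∈ A.toFinset) fun i _ => hFU i)
  rw [← hcover] at h1 h2 h3 h4
  rw [← hf.outer_clopen ((isClopen_discrete A).preimage hF), abs_le]
  constructor <;> linarith

end IsClopenSubmodular

/-! ### The Borel extension and its quotients. -/

namespace IsClopenSubmodular

variable {X : Type u} [TopologicalSpace X] {f : Set X → ℝ}

/-- The outer capacity restricted to the Borel sets. -/
noncomputable def borelExtension (hf : IsClopenSubmodular f) : SetFunction (borelAlgebra X) where
  toFun S := clopenOuter f S
  map_empty := hf.outer_empty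

theorem borelExtension_increasing (hf : IsClopenSubmodular f) : hf.borelExtension.Increasing :=
  fun _ _ h => hf.outer_mono h

theorem mem_borelAlgebra_of_isClopen {C : Set X} (hC : IsClopen C) : C ∈ borelAlgebra X :=
  MeasurableSpace.measurableSet_generateFrom hC.isOpen

theorem mem_quotientSet_borelExtension (hf : IsClopenSubmodular f) {k : ℕ} {F : X → Fin k}
    (hF : Continuous F) {x : EuclideanSpace ℝ (Set (Fin k))} (hx : ∀ A, x A = f (F ⁻¹' A)) :
    x ∈ hf.borelExtension.quotientSet k :=
  ⟨F, fun _ => mem_borelAlgebra_of_isClopen ((isClopen_discrete _).preimage hF), fun A =>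
    (hx A).trans (hf.outer_clopen ((isClopen_discrete A).preimage hF)).symm⟩

variable [CompactSpace X] [T2Space X] [TotallyDisconnectedSpace X]

theorem borelExtension_submodular (hf : IsClopenSubmodular f) : hf.borelExtension.Submodular :=
  fun X Y => hf.outer_submod X Y

/-- Every quotient of the Borel extension is a limit of quotients along continuous maps. -/
theorem quotientSet_borelExtension_subset [PolishSpace X] (hf : IsClopenSubmodular f) {k : ℕ}
    {L : Set (EuclideanSpace ℝ (Set (Fin k)))} (hL : IsClosed L)
    (h : ∀ F : X → Fin k, Continuous F → WithLp.toLp 2 (fun A => f (F ⁻¹' A)) ∈ L) :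
    hf.borelExtension.quotientSet k ⊆ L := by
  rintro x ⟨G, hG, hx⟩
  have hG' : ∀ i, MeasureTheory.AnalyticSet (G ⁻¹' {i}) := fun i => by
    let := borel X
    have : BorelSpace X := ⟨rfl⟩
    exact MeasurableSet.analyticSet (hG {i})
  choose F hF hFx using fun n : ℕ =>
    hf.exists_continuous_approx hG' (ε := 1 / (n + 1)) (by positivity)
  have hlim : Tendsto (fun n => WithLp.toLp 2 (fun A => f (F n ⁻¹' A))) atTop (𝓝 x) := by
    refine ((PiLp.continuous_toLp 2 _).tendsto (WithLp.ofLp x)).comp (tendsto_pi_nhds.2 fun A => ?_)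
    rw [tendsto_iff_dist_tendsto_zero]
    have h0 : Tendsto (fun n : ℕ => (k : ℝ) * (1 / (n + 1))) atTop (𝓝 0) := by
      simpa using tendsto_one_div_add_atTop_nhds_zero_nat.const_mul (k : ℝ)
    refine squeeze_zero (fun _ => dist_nonneg) (fun n => ?_) h0
    rw [dist_comm, Real.dist_eq]
    have := hx A
    change x.ofLp A = clopenOuter f (G ⁻¹' A) at this
    rw [this]
    exact hFx n A
  exact hL.mem_of_tendsto hlim (Eventually.of_forall fun n => h _ (hF n))

end IsClopenSubmodular

/-- If the coordinates of a map to the Cantor space are measurable with respect to a set-algebra,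
then so are the preimages of clopen sets. -/
theorem preimage_mem_of_isClopen {J : Type u} {𝓑 : BooleanSubalgebra (Set J)} {h : J → ℕ → Bool}
    (hh : ∀ m, {x | h x m = true} ∈ 𝓑) {D : Set (ℕ → Bool)} (hD : IsClopen D) : h ⁻¹' D ∈ 𝓑 := by
  have hb : ∀ m b, {x | h x m = b} ∈ 𝓑 := by
    rintro m (_ | _)
    · convert 𝓑.compl_mem (hh m)
      ext; simp
    · exact hh m
  have hfin : ∀ (I : Finset ℕ) (y : ℕ → Bool), h ⁻¹' {z | ∀ i ∈ I, z i = y i} ∈ 𝓑 := by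
    intro I y
    induction I using Finset.induction_on with
    | empty => convert 𝓑.top_mem; simp
    | insert a I ha ih =>
      convert 𝓑.inf_mem (hb a (y a)) ih
      ext; simp
  -- Compactness induction needs a property inherited by subsets. Measurability of `h ⁻¹' S` is not
  -- one, but having a measurable superset `E ⊆ D` is.
  suffices ∃ E, D ⊆ E ∧ E ⊆ D ∧ h ⁻¹' E ∈ 𝓑 by
    obtain ⟨E, h1, h2, h3⟩ := this
    rwa [h1.antisymm h2]
  refine hD.isClosed.isCompact.induction_on (p := fun S => ∃ E, S ⊆ E ∧ E ⊆ D ∧ h ⁻¹' E ∈ 𝓑)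
    ⟨∅, subset_rfl, empty_subset _, 𝓑.bot_mem⟩ ?_ ?_ ?_
  · rintro S T hST ⟨E, h1, h2⟩
    exact ⟨E, hST.trans h1, h2⟩
  · rintro S T ⟨E, h1, h2, h3⟩ ⟨E', h1', h2', h3'⟩
    exact ⟨E ∪ E', union_subset_union h1 h1', union_subset h2 h2', 𝓑.sup_mem h3 h3'⟩
  · intro y hy
    obtain ⟨I, u, hu, huD⟩ := isOpen_pi_iff.1 hD.isOpen y hy
    have hsub : {z : ℕ → Bool | ∀ i ∈ I, z i = y i} ⊆ D := fun z hz =>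
      huD fun i hi => (show z i = y i from hz i hi) ▸ (hu i hi).2
    refine ⟨{z | ∀ i ∈ I, z i = y i}, mem_nhdsWithin_of_mem_nhds ?_,
      {z | ∀ i ∈ I, z i = y i}, subset_rfl, hsub, hfin I y⟩
    have : {z : ℕ → Bool | ∀ i ∈ I, z i = y i} = (I : Set ℕ).pi fun i => {y i} := by
      ext
      simp only [mem_ofPred_eq, Set.mem_pi, mem_singleton_iff, Finset.mem_coe]
    rw [this]
    exact set_pi_mem_nhds I.finite_toSet fun i _ => (isOpen_discrete _).mem_nhds rfl

/-! ### Hausdorff limits of sequences of sets. -/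

/-- Passing to closures does not change Hausdorff distances, and the space of closed sets is
complete. -/
theorem exists_closed_limit {E : Type u} [EMetricSpace E] [CompleteSpace E] {Q : ℕ → Set E}
    (h : ∀ ε : ℝ≥0∞, 0 < ε → ∃ N, ∀ m, N ≤ m → ∀ n, N ≤ n → hausdorffEDist (Q m) (Q n) < ε) :
    ∃ L, IsClosed L ∧ Tendsto (fun n => hausdorffEDist (Q n) L) atTop (𝓝 0) := by
  have hc : CauchySeq fun n => TopologicalSpace.Closeds.closure (Q n) := by
    rw [EMetric.cauchySeq_iff]
    intro ε hε
    obtain ⟨N, hN⟩ := h ε hε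
    refine ⟨N, fun m hm n hn => ?_⟩
    rw [TopologicalSpace.Closeds.edist_eq]
    simpa [hausdorffEDist_closure] using hN m hm n hn
  obtain ⟨L, hL⟩ := cauchySeq_tendsto_of_complete hc
  refine ⟨L, L.isClosed, ?_⟩
  rw [tendsto_iff_edist_tendsto_0] at hL
  simpa [TopologicalSpace.Closeds.edist_eq, hausdorffEDist_closure_left] using hL

theorem mem_of_tendsto_of_hausdorffEDist {E : Type u} [PseudoEMetricSpace E] {Q : ℕ → Set E}
    {L : Set E} (hL : IsClosed L) {l : Filter ℕ} [l.NeBot]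
    (h : Tendsto (fun n => hausdorffEDist (Q n) L) l (𝓝 0)) {y : ℕ → E} (hy : ∀ n, y n ∈ Q n)
    {x : E} (hx : Tendsto y l (𝓝 x)) : x ∈ L := by
  rw [← hL.closure_eq, mem_closure_iff_infEDist_zero]
  have h1 : Tendsto (fun n => hausdorffEDist (Q n) L + edist x (y n)) l (𝓝 (0 + 0)) := by
    refine h.add ?_
    simpa only [edist_comm] using tendsto_iff_edist_tendsto_0.1 hx
  rw [add_zero] at h1
  refine le_antisymm (ge_of_tendsto' h1 fun n => ?_) bot_le
  exact infEDist_le_infEDist_add_edist.trans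
    (add_le_add_left (infEDist_le_hausdorffEDist_of_mem (hy n)) _)

theorem exists_tendsto_of_hausdorffEDist {E : Type u} [PseudoEMetricSpace E] {Q : ℕ → Set E}
    {L : Set E} (hQ : ∀ n, (Q n).Nonempty)
    (h : Tendsto (fun n => hausdorffEDist (Q n) L) atTop (𝓝 0)) {x : E} (hx : x ∈ L) :
    ∃ y : ℕ → E, (∀ n, y n ∈ Q n) ∧ Tendsto y atTop (𝓝 x) := by
  have key : ∀ n, ∃ y ∈ Q n, edist x y ≤ hausdorffEDist (Q n) L + (n : ℝ≥0∞)⁻¹ := by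
    intro n
    -- At infinite distance the bound is void and any point of `Q n` serves. Otherwise the slack `1
    -- / n` allows for an infimum that is not attained.
    by_cases hn : hausdorffEDist (Q n) L = ⊤
    · obtain ⟨y, hy⟩ := hQ n
      exact ⟨y, hy, by simp [hn]⟩
    · have : hausdorffEDist L (Q n) < hausdorffEDist (Q n) L + (n : ℝ≥0∞)⁻¹ := by
        rw [hausdorffEDist_comm]
        exact ENNReal.lt_add_right hn (by simp)
      obtain ⟨y, hy, hlt⟩ := exists_edist_lt_of_hausdorffEDist_lt hx this
      exact ⟨y, hy, hlt.le⟩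
  choose y hy hxy using key
  refine ⟨y, hy, tendsto_iff_edist_tendsto_0.2 ?_⟩
  have h1 := h.add ENNReal.tendsto_inv_nat_nhds_zero
  rw [add_zero] at h1
  exact tendsto_of_tendsto_of_tendsto_of_le_of_le tendsto_const_nhds h1 (fun _ => bot_le)
    fun n => by rw [edist_comm]; exact hxy n

instance : CompactSpace cantorSet := isCompact_iff_compactSpace.1 isCompact_cantorSet

instance : PolishSpace cantorSet := isClosed_cantorSet.polishSpace

instance : TotallyDisconnectedSpace cantorSet :=
  cantorSetHomeomorphNatToBool.symm.totallyDisconnectedSpace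

/-! ### Construction of the limit setfunction. -/

namespace SetFunction

theorem Increasing.nonneg {J : Type u} {𝓑 : BooleanSubalgebra (Set J)} {φ : SetFunction 𝓑}
    (h : φ.Increasing) (S : 𝓑) : 0 ≤ φ.toFun S :=
  φ.map_empty ▸ h ⊥ S (empty_subset _)

theorem Increasing.le_top {J : Type u} {𝓑 : BooleanSubalgebra (Set J)} {φ : SetFunction 𝓑}
    (h : φ.Increasing) (S : 𝓑) : φ.toFun S ≤ φ.toFun ⊤ :=
  h S ⊤ (subset_univ _)

/-- The ultralimit of the images of uniformly bounded increasing submodular setfunctions under maps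
to a space `X`, as a function of the clopen subsets of `X`. -/
theorem exists_clopen_ultralimit {X : Type v} [TopologicalSpace X] {J : ℕ → Type u}
    {𝓑 : ∀ n, BooleanSubalgebra (Set (J n))} {φ : ∀ n, SetFunction (𝓑 n)}
    (hinc : ∀ n, (φ n).Increasing) (hsub : ∀ n, (φ n).Submodular) {M : ℝ}
    (hM : ∀ n, (φ n).toFun ⊤ ≤ M) {H : ∀ n, J n → X}
    (hH : ∀ n C, IsClopen C → H n ⁻¹' C ∈ 𝓑 n) (l : Ultrafilter ℕ) :
    ∃ f : Set X → ℝ, IsClopenSubmodular f ∧ ∀ C (hC : IsClopen C),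
      Tendsto (fun n => (φ n).toFun ⟨H n ⁻¹' C, hH n C hC⟩) l (𝓝 (f C)) := by
  -- Quantifying `r` before `hC` makes `f` a function on all sets; its value `0` off the clopen sets
  -- is a dummy.
  have key : ∀ C, ∃ r : ℝ, ∀ hC : IsClopen C,
      Tendsto (fun n => (φ n).toFun ⟨H n ⁻¹' C, hH n C hC⟩) l (𝓝 r) := by
    intro C
    by_cases hC : IsClopen C
    · obtain ⟨r, -, hr⟩ := (isCompact_Icc (a := (0 : ℝ)) (b := M)).ultrafilter_le_nhds
        (l.map fun n => (φ n).toFun ⟨H n ⁻¹' C, hH n C hC⟩)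
        (le_principal_iff.2 (mem_map.2 (univ_mem' fun n =>
          ⟨(hinc n).nonneg _, ((hinc n).le_top _).trans (hM n)⟩)))
      exact ⟨r, fun _ => hr⟩
    · exact ⟨0, fun h => absurd h hC⟩
  choose f hf using key
  refine ⟨f, ⟨?_, ?_, ?_⟩, hf⟩
  · refine tendsto_nhds_unique (hf ∅ isClopen_empty) ?_
    exact tendsto_const_nhds.congr fun n => (φ n).map_empty.symm
  · intro C D hC hD h
    exact le_of_tendsto_of_tendsto' (hf C hC) (hf D hD) fun n => hinc n _ _ (preimage_mono h)
  · intro C D hC hD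
    exact le_of_tendsto_of_tendsto' ((hf _ (hC.inter hD)).add (hf _ (hC.union hD)))
      ((hf C hC).add (hf D hD)) fun n => hsub n ⟨_, hH n C hC⟩ ⟨_, hH n D hD⟩

/-- Countably many maps to finite sets are combined into a single map to the Cantor set, from which
they are recovered by continuous maps. -/
theorem exists_cantorSet_factorization {ι : Type*} [Countable ι] (k : ι → ℕ) :
    ∃ (p : ∀ i, cantorSet → Fin (k i + 1)), (∀ i, Continuous (p i)) ∧
      ∀ {J : Type u} {𝓑 : BooleanSubalgebra (Set J)} (F : ∀ i, J → Fin (k i + 1)),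
        (∀ i A, F i ⁻¹' A ∈ 𝓑) → ∃ H : J → cantorSet, (∀ C, IsClopen C → H ⁻¹' C ∈ 𝓑) ∧
          ∀ i, p i ∘ H = F i := by
  classical
  obtain ⟨e, he⟩ := exists_injective_nat ((i : ι) × Fin (k i + 1))
  -- A point `x` is encoded by one bit for each pair `(i, j)`, telling whether `F i x = j`. The map
  -- `d` decodes such a one-hot vector, with junk value `0` when no bit is set. Neither the code nor
  -- `d` depends on `F`, so the same `p` works for every ground set.
  have hdec : ∀ i, ∃ d : (Fin (k i + 1) → Bool) → Fin (k i + 1),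
      ∀ j, d (fun j' => decide (j = j')) = j :=
    fun i => ⟨fun b => if h : ∃ j, b j = true then h.choose else 0, fun j => by
      have h : ∃ j', decide (j = j') = true := ⟨j, by simp⟩
      refine (dif_pos h).trans ?_
      exact (of_decide_eq_true h.choose_spec).symm⟩
  choose d hd using hdec
  refine ⟨fun i x => d i fun j => cantorSetHomeomorphNatToBool x (e ⟨i, j⟩), fun i => ?_, ?_⟩
  · exact (continuous_of_discreteTopology (f := d i)).comp
      (continuous_pi fun j => (continuous_apply _).comp cantorSetHomeomorphNatToBool.continuous)
  · intro J 𝓑 F hF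
    let h : J → ℕ → Bool := fun x m => decide (∃ i, e ⟨i, F i x⟩ = m)
    refine ⟨fun x => cantorSetHomeomorphNatToBool.symm (h x), fun C hC => ?_, fun i => ?_⟩
    · refine preimage_mem_of_isClopen (h := h) (D := cantorSetHomeomorphNatToBool.symm ⁻¹' C)
        (fun m => ?_) (hC.preimage cantorSetHomeomorphNatToBool.symm.continuous)
      by_cases hm : ∃ s, e s = m
      · obtain ⟨⟨i, j⟩, rfl⟩ := hm
        convert hF i {j}
        ext x
        simp only [h, decide_eq_true_eq, mem_ofPred_eq, he.eq_iff, mem_preimage, mem_singleton_iff]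
        constructor
        · rintro ⟨i', h'⟩
          obtain ⟨rfl, h''⟩ := Sigma.mk.inj_iff.1 h'
          exact eq_of_heq h''
        · rintro rfl
          exact ⟨i, rfl⟩
      · convert 𝓑.bot_mem
        ext x
        simp only [h, decide_eq_true_eq, mem_ofPred_eq, bot_eq_empty, mem_empty_iff_false, iff_false]
        exact fun ⟨i, h'⟩ => hm ⟨_, h'⟩
    · ext1 x
      simp only [Function.comp_apply, Homeomorph.apply_symm_apply]
      convert hd i (F i x) using 2
      ext1 j
      simp only [h, he.eq_iff, decide_eq_decide]
      constructor
      · rintro ⟨i', h'⟩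
        obtain ⟨rfl, h''⟩ := Sigma.mk.inj_iff.1 h'
        exact eq_of_heq h''
      · rintro rfl
        exact ⟨i, rfl⟩

variable {J : ℕ → Type u} {𝓑 : ∀ n, BooleanSubalgebra (Set (J n))} {φ : ∀ n, SetFunction (𝓑 n)}

/-- A quotient on one point records the total mass, so convergence for `k = 1` makes the total
masses converge. -/
theorem bddAbove_range_top {L : Set (EuclideanSpace ℝ (Set (Fin 1)))}
    (h : Tendsto (fun n => hausdorffEDist ((φ n).quotientSet 1) L) atTop (𝓝 0))
    (hL : L.Nonempty) : BddAbove (range fun n => (φ n).toFun ⊤) := by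
  obtain ⟨x, hx⟩ := hL
  obtain ⟨y, hy, hlim⟩ := exists_tendsto_of_hausdorffEDist
    (fun n => (φ n).quotientSet_nonempty 0) h hx
  have h1 : Tendsto (fun n => y n univ) atTop (𝓝 (x univ)) :=
    ((PiLp.continuous_apply 2 _ univ).tendsto x).comp hlim
  have h2 : (fun n => (φ n).toFun ⊤) = fun n => y n univ := by
    ext1 n
    obtain ⟨F, hF, hFy⟩ := hy n
    exact (hFy univ).symm
  rw [h2]
  exact h1.bddAbove_range

theorem QuotientConvergent.exists_limit (hinc : ∀ n, (φ n).Increasing)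
    (hsub : ∀ n, (φ n).Submodular) (hc : QuotientConvergent φ) :
    ∃ ψ : SetFunction (borelAlgebra cantorSet),
      ψ.Increasing ∧ ψ.Submodular ∧ QuotientConvergesTo φ ψ := by
  choose L hL hlim using fun k : ℕ => exists_closed_limit (hc (k + 1) (Nat.le_add_left 1 k))
  have hQ : ∀ k n, ((φ n).quotientSet (k + 1)).Nonempty := fun k n =>
    (φ n).quotientSet_nonempty k
  have hne : ∀ k, (L k).Nonempty := by
    intro k
    obtain ⟨n, hn⟩ := ((hlim k).eventually (gt_mem_nhds ENNReal.zero_lt_top)).exists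
    exact nonempty_of_hausdorffEDist_ne_top (hQ k n) hn.ne
  obtain ⟨M, hM⟩ := bddAbove_range_top (hlim 0) (hne 0)
  have := fun k => (hne k).to_subtype
  let a : ∀ k, ℕ → L k := fun k => TopologicalSpace.denseSeq (L k)
  choose y hy hya using fun i : ℕ × ℕ =>
    exists_tendsto_of_hausdorffEDist (hQ i.1) (hlim i.1) (a i.1 i.2).2
  choose F hF hFy using hy
  obtain ⟨p, hp, hfac⟩ := exists_cantorSet_factorization.{u} fun i : ℕ × ℕ => i.1
  choose H hH hpH using fun n => hfac (𝓑 := 𝓑 n) (fun i => F i n) (fun i => hF i n)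
  obtain ⟨f, hf, hfl⟩ := exists_clopen_ultralimit hinc hsub (fun n => hM ⟨n, rfl⟩) hH
    (hyperfilter ℕ)
  -- The ultrafilter is nonprincipal, so limits along `atTop` are also limits along it.
  have hle : (hyperfilter ℕ : Filter ℕ) ≤ atTop := Nat.hyperfilter_le_atTop
  refine ⟨hf.borelExtension, hf.borelExtension_increasing, hf.borelExtension_submodular, ?_⟩
  intro k hk
  obtain ⟨k, rfl⟩ := Nat.exists_eq_add_of_le' hk
  have hsubset : hf.borelExtension.quotientSet (k + 1) ⊆ L k := by
    refine hf.quotientSet_borelExtension_subset (hL k) fun G hG => ?_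
    have hm : ∀ n A, (G ∘ H n) ⁻¹' A ∈ 𝓑 n := fun n A =>
      hH n _ ((isClopen_discrete A).preimage hG)
    refine mem_of_tendsto_of_hausdorffEDist (hL k) ((hlim k).mono_left hle)
      (y := fun n => WithLp.toLp 2 fun A => (φ n).toFun ⟨_, hm n A⟩)
      (fun n => ⟨G ∘ H n, hm n, fun _ => rfl⟩) ?_
    exact ((PiLp.continuous_toLp 2 _).tendsto _).comp (tendsto_pi_nhds.2 fun A =>
      hfl _ ((isClopen_discrete A).preimage hG))
  have hmem : ∀ i, (a k i : EuclideanSpace ℝ (Set (Fin (k + 1)))) ∈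
      hf.borelExtension.quotientSet (k + 1) := by
    intro i
    refine hf.mem_quotientSet_borelExtension (hp (k, i)) fun A => ?_
    have h1 : Tendsto (fun n => y (k, i) n A) (hyperfilter ℕ) (𝓝 ((a k i).1 A)) :=
      ((PiLp.continuous_apply 2 _ A).tendsto _).comp ((hya (k, i)).mono_left hle)
    -- Since `p (k, i) ∘ H n` is the map realizing `y (k, i) n`, both sides are ultralimits of the
    -- same sequence.
    refine tendsto_nhds_unique h1 ((hfl _ ((isClopen_discrete A).preimage (hp (k, i)))).congr ?_)
    intro n
    rw [hFy (k, i) n A]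
    congr 2
    exact congrArg (· ⁻¹' A) (hpH n (k, i))
  have hcl : closure (hf.borelExtension.quotientSet (k + 1)) = L k := by
    refine (closure_minimal hsubset (hL k)).antisymm fun x hx => ?_
    have h1 : (⟨x, hx⟩ : L k) ∈ closure (range (a k)) := TopologicalSpace.denseRange_denseSeq _ _
    have h2 := image_closure_subset_closure_image continuous_subtype_val
      (mem_image_of_mem Subtype.val h1)
    refine closure_mono ?_ h2
    rintro _ ⟨_, ⟨i, rfl⟩, rfl⟩
    exact hmem i
  simpa only [← hcl, hausdorffEDist_closure_right] using hlim k

/-! ### Convergence in the quotient pseudometric and completeness. -/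

theorem hausdorffEDist_quotientSet_le {J : Type u} {𝓑 : BooleanSubalgebra (Set J)}
    {φ : SetFunction 𝓑} {J' : Type v} {𝓑' : BooleanSubalgebra (Set J')} {ψ : SetFunction 𝓑'}
    (hφ : φ.Increasing) (hψ : ψ.Increasing) (k : ℕ) :
    hausdorffEDist (φ.quotientSet (k + 1)) (ψ.quotientSet (k + 1)) ≤
      ENNReal.ofReal (√2 ^ (k + 1) * (φ.toFun ⊤ + ψ.toFun ⊤)) := by
  obtain ⟨x₀, hx₀⟩ := φ.quotientSet_nonempty k
  obtain ⟨y₀, hy₀⟩ := ψ.quotientSet_nonempty k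
  refine hausdorffEDist_le_of_mem_edist
    (fun x hx => ⟨y₀, hy₀, edist_le_of_mem_quotientSet hφ hψ hx hy₀⟩)
    (fun y hy => ⟨x₀, hx₀, ?_⟩)
  rw [edist_comm]
  exact edist_le_of_mem_quotientSet hφ hψ hx₀ hy

/-- Dominated convergence for the counting measure: distances in dimension `2 ^ k` grow at most like
`√2 ^ k` times the bounded total masses, so the weights `2 ^ (-k)` leave a geometric majorant of
ratio `√2 / 2`. -/
theorem QuotientConvergesTo.tendsto_quotientEDist {J' : Type v} {𝓑' : BooleanSubalgebra (Set J')}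
    {ψ : SetFunction 𝓑'} (hinc : ∀ n, (φ n).Increasing) (hψ : ψ.Increasing)
    (h : QuotientConvergesTo φ ψ) :
    Tendsto (fun n => (φ n).quotientEDist ψ) atTop (𝓝 0) := by
  obtain ⟨M, hM⟩ := bddAbove_range_top (h 1 le_rfl) (ψ.quotientSet_nonempty 0)
  replace hM : ∀ n, (φ n).toFun ⊤ ≤ M := fun n => hM ⟨n, rfl⟩
  have hs : √2 / 2 < 1 := by
    have : √2 < 2 := by
      rw [Real.sqrt_lt' (by norm_num)]; norm_num
    linarith
  have hsum : Summable fun k : ℕ => (√2 / 2) ^ (k + 1) * (M + ψ.toFun ⊤) :=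
    ((summable_nat_add_iff 1).2 (summable_geometric_of_lt_one (by positivity) hs)).mul_right _
  have key := MeasureTheory.tendsto_lintegral_of_dominated_convergence
    (μ := MeasureTheory.Measure.count)
    (F := fun n k => (2⁻¹ : ℝ≥0∞) ^ (k + 1) *
      hausdorffEDist ((φ n).quotientSet (k + 1)) (ψ.quotientSet (k + 1)))
    (f := fun _ => 0)
    (fun k : ℕ => ENNReal.ofReal ((√2 / 2) ^ (k + 1) * (M + ψ.toFun ⊤)))
    (fun _ => measurable_from_top) (fun n => Eventually.of_forall fun k => ?_)
    (by rw [MeasureTheory.lintegral_count]; exact hsum.tsum_ofReal_ne_top)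
    (Eventually.of_forall fun k => ?_)
  · simpa only [MeasureTheory.lintegral_count, MeasureTheory.lintegral_zero, quotientEDist] using key
  · have h2 : (2⁻¹ : ℝ≥0∞) ^ (k + 1) = ENNReal.ofReal ((2⁻¹ : ℝ) ^ (k + 1)) := by
      rw [ENNReal.ofReal_pow (by norm_num), ENNReal.ofReal_inv_of_pos (by norm_num)]
      simp
    calc (2⁻¹ : ℝ≥0∞) ^ (k + 1) *
          hausdorffEDist ((φ n).quotientSet (k + 1)) (ψ.quotientSet (k + 1))
        ≤ ENNReal.ofReal ((2⁻¹ : ℝ) ^ (k + 1)) *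
          ENNReal.ofReal (√2 ^ (k + 1) * (M + ψ.toFun ⊤)) := by
          rw [h2]
          gcongr
          refine (hausdorffEDist_quotientSet_le (hinc n) hψ k).trans ?_
          gcongr
          exact hM n
      _ = ENNReal.ofReal ((√2 / 2) ^ (k + 1) * (M + ψ.toFun ⊤)) := by
          rw [← ENNReal.ofReal_mul (by positivity), ← mul_assoc, ← mul_pow]
          congr 3
          ring
  · have h0 := ENNReal.Tendsto.const_mul (a := (2⁻¹ : ℝ≥0∞) ^ (k + 1))
      (h (k + 1) (Nat.le_add_left 1 k)) (Or.inr (ENNReal.pow_ne_top (by simp)))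
    simpa using h0

/-- The copy of a setfunction on a lift of its ground set to a higher universe. -/
def uliftGround {J : Type v} {𝓑 : BooleanSubalgebra (Set J)} (φ : SetFunction 𝓑) :
    SetFunction (J := ULift.{u} J)
      { carrier := {s | ULift.up ⁻¹' s ∈ 𝓑}
        supClosed' := fun _ hs _ ht => 𝓑.sup_mem hs ht
        infClosed' := fun _ hs _ ht => 𝓑.inf_mem hs ht
        compl_mem' := fun hs => 𝓑.compl_mem hs
        bot_mem' := 𝓑.bot_mem } where
  toFun S := φ.toFun ⟨ULift.up ⁻¹' S.1, S.2⟩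
  map_empty := φ.map_empty

theorem quotientSet_uliftGround {J : Type v} {𝓑 : BooleanSubalgebra (Set J)} (φ : SetFunction 𝓑)
    (k : ℕ) : (uliftGround.{u} φ).quotientSet k = φ.quotientSet k := by
  ext x
  constructor
  · rintro ⟨F, hF, hx⟩
    exact ⟨F ∘ ULift.up, hF, hx⟩
  · rintro ⟨F, hF, hx⟩
    exact ⟨F ∘ ULift.down, hF, hx⟩

theorem QuotientConvergent.of_quotientEDist
    (h : ∀ ε : ℝ≥0∞, 0 < ε → ∃ N : ℕ, ∀ m, N ≤ m → ∀ n, N ≤ n →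
      (φ m).quotientEDist (φ n) < ε) : QuotientConvergent φ := by
  intro k hk ε hε
  obtain ⟨k, rfl⟩ := Nat.exists_eq_add_of_le' hk
  have hc : (2⁻¹ : ℝ≥0∞) ^ (k + 1) ≠ 0 := pow_ne_zero _ (by simp)
  obtain ⟨N, hN⟩ := h ((2⁻¹ : ℝ≥0∞) ^ (k + 1) * ε) (ENNReal.mul_pos hc hε.ne')
  refine ⟨N, fun m hm n hn => ?_⟩
  refine lt_of_mul_lt_mul_left' (a := (2⁻¹ : ℝ≥0∞) ^ (k + 1)) (lt_of_le_of_lt ?_ (hN m hm n hn))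
  exact ENNReal.le_tsum (f := fun k : ℕ => (2⁻¹ : ℝ≥0∞) ^ (k + 1) *
    hausdorffEDist ((φ m).quotientSet (k + 1)) ((φ n).quotientSet (k + 1))) k

end SetFunction

theorem mainTheorem1 :
    (∀ (J : ℕ → Type u) (𝓑 : ∀ n, BooleanSubalgebra (Set (J n)))
        (φ : ∀ n, SetFunction (𝓑 n)),
      (∀ n, (φ n).Increasing) → (∀ n, (φ n).Submodular) →
      SetFunction.QuotientConvergent φ →
      ∃ ψ : SetFunction (borelAlgebra cantorSet),
        ψ.Increasing ∧ ψ.Submodular ∧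
        SetFunction.QuotientConvergesTo φ ψ ∧
        Tendsto (fun n => (φ n).quotientEDist ψ) atTop (𝓝 0)) ∧
    CompleteSpace IncreasingSubmodularSpace.{u} := by
  constructor
  · intro J 𝓑 φ hinc hsub hc
    obtain ⟨ψ, h1, h2, h3⟩ := hc.exists_limit hinc hsub
    exact ⟨ψ, h1, h2, h3, h3.tendsto_quotientEDist hinc h1⟩
  · refine EMetric.complete_of_cauchySeq_tendsto fun s hs => ?_
    have hc : SetFunction.QuotientConvergent fun n => (s n).setFunction :=
      .of_quotientEDist (EMetric.cauchySeq_iff.1 hs)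
    obtain ⟨ψ, h1, h2, h3⟩ := hc.exists_limit (fun n => (s n).increasing) fun n => (s n).submodular
    -- The Cantor set lives in universe `0`, so the limit is lifted to universe `u`; its quotient
    -- sets do not change.
    refine ⟨⟨_, _, ψ.uliftGround, fun X Y h => h1 _ _ (preimage_mono h),
      fun X Y => h2 ⟨_, X.2⟩ ⟨_, Y.2⟩⟩, tendsto_iff_edist_tendsto_0.2 ?_⟩
    have h4 := h3.tendsto_quotientEDist (fun n => (s n).increasing) h1
    refine h4.congr fun n => ?_
    change _ = (s n).setFunction.quotientEDist ψ.uliftGround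
    simp only [SetFunction.quotientEDist, SetFunction.quotientSet_uliftGround]
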